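/- **Theorem (Properly decomposable functions).** Let $f\colon\mathbb{R}^d\to\mathbb{R}$ be locally Lipschitz and let $\bar x$ be a local minimizer of $f$. Write $\partial f(x)$ for the Clarke subdifferential, i.e. the convex hull of all limits $\lim_i\nabla f(x_i)$ along sequences $x_i\to x$ of points of differentiability of $f$. A function $h\colon\mathbb{R}^m\to\mathbb{R}$ is called sublinear if its epigraph is a closed convex cone, and then $\mathrm{lin}(h)=\{y : h(y)=-h(-y)\}$. Suppose that $f$ is properly $C^4$ decomposable at $\bar x$ as $h\circ c$: there are a $C^4$ map $c\colon\mathbb{R}^d\to\mathbb{R}^m$ with $c(\bar x)=0$ and a sublinear function $h\colon\mathbb{R}^m\to\mathbb{R}$ such that $f(x)=f(\bar x)+h(c(x))$ for all $x$ near $\bar x$ and $$\mathrm{lin}(h)+\mathrm{range}(\nabla c(\bar x))=\mathbb{R}^m .$$ Suppose furthermore that 1. (strict complementarity) $0\in\mathrm{ri}\,\partial f(\bar x)$, where $\mathrm{ri}$ is the relative interior; 2. (quadratic growth) there is $\gamma>0$ with $f(x)-f(\bar x)\ge\frac{\gamma}{2}\|x-\bar x\|^2$ for all $x$ near $\bar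 x$. Then $f$ satisfies the following Assumption A at $\bar x$ with the set $\mathcal{M}:=c^{-1}(\mathrm{lin}(h))$: $f$ is locally Lipschitz with local minimizer $\bar x$, and * (A1) the quadratic growth bound 2 holds; * (A2) $\mathcal{M}$ is an active $C^4$-manifold for $f$ around $\bar x$: $\bar x\in\mathcal{M}$ and $0\in\partial f(\bar x)$; near $\bar x$ the set $\mathcal{M}$ is the zero set of a $C^4$ map into some $\mathbb{R}^k$ with surjective Jacobian; the restriction of $f$ to $\mathcal{M}$ agrees near $\bar x$ with a $C^4$ function defined on a neighborhood of $\bar x$; and there is a neighborhood $U$ of $\bar x$ with $\inf\{\|v\| : v\in\partial f(x),\ x\in U\setminus\mathcal{M}\}>0$ (where $\inf\emptyset=+\infty$); * (A3) there is $C>0$ such that $\|P_{T_{\mathcal{M}}(y)}(v-\nabla_{\mathcal{M}}f(y))\|\le C\|x-y\|$ for all $x$ near $\bar x$, all $v\in\partial f(x)$ and all $y\in\mathcal{M}$ near $\bar x$. Here $T_{\mathcal{M}}(y)$ is the kernel of the Jacobian at $y$ of any local defining map of $\mathcal{M}$ around $y$, $P_{T}$ is the orthogonal projection onto $T$, and $\nabla_{\mathcal{M}}f(y)=P_{T_{\mathcal{M}}(y)}(\nabla\hat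 f(y))$ for any smooth function $\hat f$ that is defined on a neighborhood of $y$ and agrees there with $f$ on $\mathcal{M}$; * (A4) there is a function $o\colon\mathbb{R}\to\mathbb{R}$ with $\lim_{t\to0}o(t)/t=0$ such that $f(y)\ge f(x)+\langle v,y-x\rangle+o(\|y-x\|)$ for all $x$ near $\bar x$, all $v\in\partial f(x)$ and all $y\in\mathcal{M}$ near $\bar x$. -/

import Mathlib

open Set Filter Topology

namespace NonsmoothOpt

/-- `ℝ^d` with its Euclidean norm and inner product. -/
abbrev Euc (d : ℕ) := EuclideanSpace ℝ (Fin d)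

/-! ### Subdifferential and growth -/

/-- The Clarke subdifferential of `f` at `x` : the convex hull of all limits of gradients
`∇ f (x_i)` along sequences of differentiability points `x_i → x`. -/
def clarkeSubdifferential {d : ℕ} (f : Euc d → ℝ) (x : Euc d) : Set (Euc d) :=
  convexHull ℝ {v | ∃ u : ℕ → Euc d, (∀ i, DifferentiableAt ℝ f (u i)) ∧
    Tendsto u atTop (𝓝 x) ∧ Tendsto (fun i => gradient f (u i)) atTop (𝓝 v)}

/-- Quadratic growth of `f` at `xbar`. -/
def QuadraticGrowth {d : ℕ} (f : Euc d → ℝ) (xbar : Euc d) : Prop :=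
  ∃ γ : ℝ, 0 < γ ∧ ∀ᶠ x in 𝓝 xbar, γ / 2 * ‖x - xbar‖ ^ 2 ≤ f x - f xbar

/-- Strict complementarity: `0` lies in the relative interior of the Clarke subdifferential. -/
def StrictComplementarity {d : ℕ} (f : Euc d → ℝ) (xbar : Euc d) : Prop :=
  (0 : Euc d) ∈ intrinsicInterior ℝ (clarkeSubdifferential f xbar)

/-! ### Sublinear functions and proper decomposability -/

/-- The epigraph of a real-valued function. -/
def epigraph {m : ℕ} (h : Euc m → ℝ) : Set (Euc m × ℝ) := {z | h z.1 ≤ z.2}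

/-- `h` is sublinear: its epigraph is a closed convex cone. -/
structure IsSublinear {m : ℕ} (h : Euc m → ℝ) : Prop where
  isClosed : IsClosed (epigraph h)
  convex : Convex ℝ (epigraph h)
  cone : ∀ r : ℝ, 0 < r → ∀ z ∈ epigraph h, r • z ∈ epigraph h

/-- The lineality space of `h`. -/
def lineality {m : ℕ} (h : Euc m → ℝ) : Set (Euc m) := {y | h y = -h (-y)}

open scoped Pointwise in
/-- `f` is properly `C^p` decomposable at `xbar` as `h ∘ c`. (Properness of `h` is automatic, as
`h` is real-valued; closedness is part of `IsSublinear`.) -/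
structure IsProperlyDecomposableAs {d m : ℕ} (p : ℕ) (f : Euc d → ℝ) (xbar : Euc d)
    (h : Euc m → ℝ) (c : Euc d → Euc m) : Prop where
  smooth : ContDiff ℝ p c
  map_base : c xbar = 0
  sublinear : IsSublinear h
  decomp : ∀ᶠ x in 𝓝 xbar, f x = f xbar + h (c x)
  transversality : lineality h + Set.range (fderiv ℝ c xbar) = Set.univ

/-! ### Manifolds, tangent spaces, covariant gradients -/

/-- `F` is a `C^p` map on the open neighbourhood `U` of `x`, with surjective Jacobian, whose zero
set is `M ∩ U`. -/
structure IsDefiningMap {d k : ℕ} (p : ℕ) (M : Set (Euc d)) (x : Euc d) (U : Set (Euc d))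
    (F : Euc d → Euc k) : Prop where
  isOpen : IsOpen U
  mem : x ∈ U
  smooth : ContDiffOn ℝ p F U
  surjective : ∀ z ∈ U, Function.Surjective (fderiv ℝ F z)
  zero_set : M ∩ U = {z ∈ U | F z = 0}

/-- `M` is a `C^p`-smooth manifold around `x`. -/
def IsManifoldAround {d : ℕ} (p : ℕ) (M : Set (Euc d)) (x : Euc d) : Prop :=
  ∃ (k : ℕ) (U : Set (Euc d)) (F : Euc d → Euc k), IsDefiningMap p M x U F

open scoped Classical in
/-- The tangent space `T_M(y) = ker ∇F(y)`, where `F` is any local defining map of `M` around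
`y ∈ M` (see `tangentSpace_eq` for the independence of the choice). -/
noncomputable def tangentSpace {d : ℕ} (M : Set (Euc d)) (y : Euc d) : Submodule ℝ (Euc d) :=
  if hM : IsManifoldAround 1 M y then
    LinearMap.ker (fderiv ℝ hM.choose_spec.choose_spec.choose y).toLinearMap
  else ⊥

/-- `fhat` is a `C^q` function on the open neighbourhood `U` of `x` which agrees with `f` on
`U ∩ M`. -/
structure IsSmoothExtension {d : ℕ} (q : ℕ) (f : Euc d → ℝ) (M : Set (Euc d)) (x : Euc d)
    (U : Set (Euc d)) (fhat : Euc d → ℝ) : Prop where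
  isOpen : IsOpen U
  mem : x ∈ U
  smooth : ContDiffOn ℝ q fhat U
  agree : ∀ z ∈ U ∩ M, fhat z = f z

/-- The restriction of `f` to `M` is `C^q`-smooth around `x`. -/
def IsSmoothAlong {d : ℕ} (q : ℕ) (f : Euc d → ℝ) (M : Set (Euc d)) (x : Euc d) : Prop :=
  ∃ (U : Set (Euc d)) (fhat : Euc d → ℝ), IsSmoothExtension q f M x U fhat

open scoped Classical in
/-- The covariant gradient `∇_M f(y) = P_{T_M(y)} (∇ fhat(y))`, where `fhat` is any smooth local
extension of `f|_M` around `y ∈ M` (see `covariantGradient_eq` for the independence of the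
choice). -/
noncomputable def covariantGradient {d : ℕ} (f : Euc d → ℝ) (M : Set (Euc d)) (y : Euc d) :
    Euc d :=
  if hf : IsSmoothAlong 1 f M y then
    (tangentSpace M y).starProjection (gradient hf.choose_spec.choose y)
  else 0

/-- A `C^1` function which vanishes on `M` near `y ∈ M` has zero derivative on `ker ∇F(y)`. -/
theorem fderiv_eq_zero_of_vanish {d k : ℕ} {M : Set (Euc d)} {y : Euc d} {U V : Set (Euc d)}
    {F : Euc d → Euc k} (hF : IsDefiningMap 1 M y U F) (hy : y ∈ M) (hV : IsOpen V) (hyV : y ∈ V)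
    {φ : Euc d → ℝ} (hφ : ContDiffOn ℝ 1 φ V) (h0 : ∀ z ∈ V ∩ M, φ z = 0)
    {v : Euc d} (hv : fderiv ℝ F y v = 0) : fderiv ℝ φ y v = 0 := by
  have hFy : F y = 0 := by
    have : y ∈ {z ∈ U | F z = 0} := hF.zero_set ▸ ⟨hy, hF.mem⟩
    exact this.2
  have hFs : HasStrictFDerivAt F (fderiv ℝ F y) y :=
    (hF.smooth.contDiffAt (hF.isOpen.mem_nhds hF.mem)).hasStrictFDerivAt (by norm_num)
  have hφs : HasStrictFDerivAt φ (fderiv ℝ φ y) y :=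
    (hφ.contDiffAt (hV.mem_nhds hyV)).hasStrictFDerivAt (by norm_num)
  have hext : IsLocalExtrOn φ {x | F x = F y} y := by
    left
    have hUV : U ∩ V ∈ 𝓝 y := (hF.isOpen.inter hV).mem_nhds ⟨hF.mem, hyV⟩
    filter_upwards [mem_nhdsWithin_of_mem_nhds hUV, self_mem_nhdsWithin] with z hz hz2
    have hzM : z ∈ M ∩ U := by
      rw [hF.zero_set]
      exact ⟨hz.1, by simpa [hFy] using hz2⟩
    rw [h0 y ⟨hyV, hy⟩, h0 z ⟨hz.2, hzM.1⟩]
  obtain ⟨Λ, Λ₀, hne, hΛ⟩ := hext.exists_linear_map_of_hasStrictFDerivAt hFs hφs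
  by_contra hcon
  have h1 := hΛ v
  rw [hv, map_zero, zero_add, smul_eq_mul] at h1
  have hΛ₀ : Λ₀ = 0 := (mul_eq_zero.mp h1).resolve_right hcon
  apply hne
  have hΛ0 : Λ = 0 := by
    ext1 w
    obtain ⟨x, rfl⟩ := hF.surjective y hF.mem w
    have := hΛ x
    simpa [hΛ₀] using this
  rw [hΛ0, hΛ₀]
  rfl

theorem ker_le_ker {d k l : ℕ} {M : Set (Euc d)} {y : Euc d} {U V : Set (Euc d)}
    {F : Euc d → Euc k} {G : Euc d → Euc l} (hF : IsDefiningMap 1 M y U F)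
    (hG : IsDefiningMap 1 M y V G) (hy : y ∈ M) :
    LinearMap.ker (fderiv ℝ F y).toLinearMap ≤ LinearMap.ker (fderiv ℝ G y).toLinearMap := by
  intro v hv
  have hv' : fderiv ℝ F y v = 0 := hv
  have hGd : DifferentiableAt ℝ G y :=
    (hG.smooth.contDiffAt (hG.isOpen.mem_nhds hG.mem)).differentiableAt (by norm_num)
  change fderiv ℝ G y v = 0
  ext i
  have hz : ∀ z ∈ V ∩ M, (EuclideanSpace.proj i : Euc l →L[ℝ] ℝ) (G z) = 0 := by
    intro z hz
    have : z ∈ {z ∈ V | G z = 0} := hG.zero_set ▸ ⟨hz.2, hz.1⟩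
    rw [this.2, map_zero]
  have h := fderiv_eq_zero_of_vanish hF hy hG.isOpen hG.mem
    (φ := fun z => (EuclideanSpace.proj i : Euc l →L[ℝ] ℝ) (G z))
    ((EuclideanSpace.proj i : Euc l →L[ℝ] ℝ).contDiff.comp_contDiffOn hG.smooth) hz hv'
  have hd : HasFDerivAt (fun z => (EuclideanSpace.proj i : Euc l →L[ℝ] ℝ) (G z))
      ((EuclideanSpace.proj i : Euc l →L[ℝ] ℝ).comp (fderiv ℝ G y)) y :=
    (EuclideanSpace.proj i : Euc l →L[ℝ] ℝ).hasFDerivAt.comp y hGd.hasFDerivAt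
  rw [hd.fderiv] at h
  simpa using h

/-- The tangent space does not depend on the defining map. -/
theorem tangentSpace_eq {d k : ℕ} {M : Set (Euc d)} {y : Euc d} {U : Set (Euc d)}
    {F : Euc d → Euc k} (hF : IsDefiningMap 1 M y U F) (hy : y ∈ M) :
    tangentSpace M y = LinearMap.ker (fderiv ℝ F y).toLinearMap := by
  have hM : IsManifoldAround 1 M y := ⟨k, U, F, hF⟩
  rw [tangentSpace, dif_pos hM]
  have hG := hM.choose_spec.choose_spec.choose_spec
  exact le_antisymm (ker_le_ker hG hF hy) (ker_le_ker hF hG hy)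

/-- The covariant gradient does not depend on the smooth extension. -/
theorem covariantGradient_eq {d : ℕ} {f : Euc d → ℝ} {M : Set (Euc d)} {y : Euc d}
    (hM : IsManifoldAround 1 M y) (hy : y ∈ M) {U : Set (Euc d)} {fhat : Euc d → ℝ}
    (hf : IsSmoothExtension 1 f M y U fhat) :
    covariantGradient f M y = (tangentSpace M y).starProjection (gradient fhat y) := by
  have hS : IsSmoothAlong 1 f M y := ⟨U, fhat, hf⟩
  rw [covariantGradient, dif_pos hS]
  obtain ⟨k, V, F, hF⟩ := hM
  have hg := hS.choose_spec.choose_spec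
  set W := hS.choose
  set g := hS.choose_spec.choose
  have hgd : DifferentiableAt ℝ g y :=
    (hg.smooth.contDiffAt (hg.isOpen.mem_nhds hg.mem)).differentiableAt (by norm_num)
  have hfd : DifferentiableAt ℝ fhat y :=
    (hf.smooth.contDiffAt (hf.isOpen.mem_nhds hf.mem)).differentiableAt (by norm_num)
  rw [← sub_eq_zero, ← map_sub, Submodule.starProjection_apply_eq_zero_iff,
    Submodule.mem_orthogonal]
  intro v hv
  rw [tangentSpace_eq hF hy] at hv
  have h := fderiv_eq_zero_of_vanish hF hy (hg.isOpen.inter hf.isOpen) ⟨hg.mem, hf.mem⟩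
    (φ := fun z => g z - fhat z)
    ((hg.smooth.mono inter_subset_left).sub (hf.smooth.mono inter_subset_right))
    (fun z hz => by rw [hg.agree z ⟨hz.1.1, hz.2⟩, hf.agree z ⟨hz.1.2, hz.2⟩, sub_self]) hv
  rw [fderiv_fun_sub hgd hfd] at h
  rw [real_inner_comm, inner_sub_left]
  simpa [gradient] using h

/-! ### Active manifolds and the regularity assumption -/

/-- `M` is an active `C^p`-manifold for `f` around `xbar`. The sharpness condition says that
`inf {‖v‖ : v ∈ ∂f(x), x ∈ U \ M} > 0`, the infimum of the empty set being `+∞`. -/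
structure IsActiveManifold {d : ℕ} (p : ℕ) (f : Euc d → ℝ) (xbar : Euc d) (M : Set (Euc d)) :
    Prop where
  mem : xbar ∈ M
  critical : (0 : Euc d) ∈ clarkeSubdifferential f xbar
  manifold : IsManifoldAround p M xbar
  smooth : IsSmoothAlong p f M xbar
  sharp : ∃ U ∈ 𝓝 xbar, ∃ μ : ℝ, 0 < μ ∧
    ∀ x ∈ U \ M, ∀ v ∈ clarkeSubdifferential f x, μ ≤ ‖v‖

/-- Strong `(a)`-regularity of `f` along `M` at `xbar`. -/
def StrongA {d : ℕ} (f : Euc d → ℝ) (xbar : Euc d) (M : Set (Euc d)) : Prop :=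
  ∃ C : ℝ, 0 < C ∧ ∃ U ∈ 𝓝 xbar, ∀ x ∈ U, ∀ v ∈ clarkeSubdifferential f x, ∀ y ∈ M ∩ U,
    ‖(tangentSpace M y).starProjection (v - covariantGradient f M y)‖ ≤ C * ‖x - y‖

/-- `(b_≤)`-regularity of `f` along `M` at `xbar`. -/
def BLeRegular {d : ℕ} (f : Euc d → ℝ) (xbar : Euc d) (M : Set (Euc d)) : Prop :=
  ∃ o : ℝ → ℝ, Tendsto (fun t => o t / t) (𝓝[≠] 0) (𝓝 0) ∧
    ∃ U ∈ 𝓝 xbar, ∀ x ∈ U, ∀ v ∈ clarkeSubdifferential f x, ∀ y ∈ M ∩ U,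
      f x + inner ℝ v (y - x) + o ‖y - x‖ ≤ f y

/-- The main structural assumption on `f` at the local minimizer `xbar`, with active manifold
`M`. -/
structure AssumptionA {d : ℕ} (f : Euc d → ℝ) (xbar : Euc d) (M : Set (Euc d)) : Prop where
  locallyLipschitz : LocallyLipschitz f
  isLocalMin : IsLocalMin f xbar
  quadraticGrowth : QuadraticGrowth f xbar
  active : IsActiveManifold 4 f xbar M
  strongA : StrongA f xbar M
  bLeRegular : BLeRegular f xbar M

end NonsmoothOpt

/-! Near `xbar` the chain rule writes every Clarke subgradient of `f` at `x` as `∇c(x)ᵀ s` with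
`s ∈ ∂h(c x)`. Sublinearity gives `∂h(y) ⊆ ∂h(0)`, and every `s ∈ ∂h(0)` agrees with `h` on `lin h`;
hence each `x ↦ f(xbar) + ⟨s, c x⟩` with `s ∈ ∂h(0)` is a smooth extension of `f` from
`M = c⁻¹(lin h)`. Regularity along `M` then comes down to Taylor estimates for `c` with a single
fixed `s`.

For sharpness it suffices that `∇c(xbar)ᵀ s ≠ 0` whenever `s ∈ ∂h(q)` and `q ∉ lin h`: as `∂h` is
invariant under positive scaling and under translation along `lin h`, only the compact family of
`∂h(q)` with `q ⊥ lin h` and `‖q‖ = 1` matters. If `∇c(xbar)ᵀ s = 0`, transversality lets us take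
`q = ∇c(xbar) w` modulo `lin h`, and then `h(q) = ⟨s, q⟩ = 0`. Now `⟨w, ·⟩` is at most `0` on
`∂f(xbar)`, hence identically `0` there by strict complementarity. Transversality also shows that
every differentiability point `z` of `h` is, up to positive scaling and a translation along `lin h`,
of the form `c(u)` with `u` arbitrarily close to `xbar`, so `∂f(xbar)` contains
`∇c(xbar)ᵀ ∇h(z)`. Therefore `⟨∇h(z), q⟩ = 0`, so `h` does not decrease along `q`, and
`h(-q) ≤ 0` puts `q` into `lin h`.
-/

namespace NonsmoothOpt

open ContinuousLinearMap (adjoint)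
open scoped NNReal

section ClosedProjection

variable {X Y : Type*} [TopologicalSpace X] [TopologicalSpace Y]

theorem isClosed_setOf_exists_mem_of_isCompact {K : Set Y} (hK : IsCompact K) {C : Set (X × Y)}
    (hC : IsClosed C) : IsClosed {x | ∃ y ∈ K, (x, y) ∈ C} := by
  refine isOpen_compl_iff.1 (isOpen_iff_mem_nhds.2 fun x hx => ?_)
  have hfar : ∀ᶠ x' in 𝓝 x, ∀ y ∈ K, (x', y) ∉ C :=
    hK.eventually_forall_of_forall_eventually fun y hy =>
      hC.isOpen_compl.mem_nhds fun hxy => hx ⟨y, hy, hxy⟩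
  filter_upwards [hfar] with x' hx' ⟨y, hy, hxy⟩ using hx' y hy hxy

end ClosedProjection

section RelativeInterior

variable {E : Type*} [NormedAddCommGroup E] [NormedSpace ℝ E] {D : Set E} {x v : E}

theorem eventually_lineMap_mem_of_mem_intrinsicInterior (hx : x ∈ intrinsicInterior ℝ D)
    (hv : v ∈ D) : ∀ᶠ t : ℝ in 𝓝 0, AffineMap.lineMap x v t ∈ D := by
  obtain ⟨y, hy, rfl⟩ := mem_intrinsicInterior.1 hx
  let line (t : ℝ) : affineSpan ℝ D :=
    ⟨AffineMap.lineMap (y : E) v t, AffineMap.lineMap_mem t y.2 (subset_affineSpan ℝ D hv)⟩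
  have hline : Continuous line := AffineMap.lineMap_continuous.subtype_mk _
  have hline_zero : line 0 = y := Subtype.ext (AffineMap.lineMap_apply_zero (y : E) v)
  exact (hline.tendsto' 0 y hline_zero).eventually (mem_interior_iff_mem_nhds.1 hy)

theorem eq_of_isMaxOn_of_mem_intrinsicInterior {φ : E →ₗ[ℝ] ℝ} (hφ : IsMaxOn φ D x)
    (hx : x ∈ intrinsicInterior ℝ D) (hv : v ∈ D) : φ v = φ x := by
  refine le_antisymm (hφ hv) ?_
  obtain ⟨t, ht, ht_neg⟩ := ((eventually_lineMap_mem_of_mem_intrinsicInterior hx hv).filter_mono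
    nhdsWithin_le_nhds |>.and (self_mem_nhdsWithin (s := Iio (0 : ℝ)))).exists
  have hle : t * (φ v - φ x) + φ x ≤ φ x := by
    simpa [AffineMap.lineMap_apply] using hφ ht
  have hmul : t * (φ v - φ x) ≤ 0 := by linarith
  exact sub_nonneg.1 (nonneg_of_mul_nonpos_right hmul ht_neg)

end RelativeInterior

section HahnBanach

variable {X Y : Type*} [AddCommGroup X] [Module ℝ X] [AddCommGroup Y] [Module ℝ Y]

theorem exists_comp_eq_of_le_sublinear_comp {N : Y → ℝ}
    (N_hom : ∀ r : ℝ, 0 < r → ∀ y, N (r • y) = r * N y) (N_add : ∀ y z, N (y + z) ≤ N y + N z)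
    (T : X →ₗ[ℝ] Y) {φ : X →ₗ[ℝ] ℝ} (hφ : ∀ x, φ x ≤ N (T x)) :
    ∃ g : Y →ₗ[ℝ] ℝ, g ∘ₗ T = φ ∧ ∀ y, g y ≤ N y := by
  have N_zero : N 0 = 0 := by
    have := N_hom 2 two_pos 0
    rw [smul_zero] at this
    linarith
  have hker : φ ∈ (LinearMap.ker T).dualAnnihilator := by
    refine (Submodule.mem_dualAnnihilator φ).2 fun x (hx : T x = 0) => ?_
    have hpos := hφ x
    have hneg := hφ (-x)
    rw [map_neg, map_neg, hx, neg_zero, N_zero] at hneg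
    rw [hx, N_zero] at hpos
    linarith
  rw [← LinearMap.range_dualMap_eq_dualAnnihilator_ker] at hker
  obtain ⟨ψ, rfl⟩ := hker
  obtain ⟨g, hg_ext, hg_le⟩ := exists_extension_of_le_sublinear
    ⟨LinearMap.range T, ψ.domRestrict _⟩ N N_hom N_add (by rintro ⟨_, x, rfl⟩; exact hφ x)
  exact ⟨g, LinearMap.ext fun x => hg_ext ⟨T x, x, rfl⟩, hg_le⟩

end HahnBanach

section Subdifferential

variable {E : Type*} [NormedAddCommGroup E] [InnerProductSpace ℝ E] {h : E → ℝ}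

/-- The subdifferential of convex analysis: the slopes of the affine minorants of `h` that are
exact at `x`. -/
def subdifferential (h : E → ℝ) (x : E) : Set E := {s | ∀ y, h x + inner ℝ s (y - x) ≤ h y}

theorem convex_subdifferential (h : E → ℝ) (x : E) : Convex ℝ (subdifferential h x) := by
  intro s hs t ht a b ha hb hab y
  calc h x + inner ℝ (a • s + b • t) (y - x)
      = a * (h x + inner ℝ s (y - x)) + b * (h x + inner ℝ t (y - x)) := by
        rw [inner_add_left, real_inner_smul_left, real_inner_smul_left]
        linear_combination (-h x) * hab
    _ ≤ a * h y + b * h y := by gcongr <;> simp only [hs y, ht y]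
    _ = h y := by rw [← add_mul, hab, one_mul]

theorem isClosed_setOf_mem_subdifferential (hh : Continuous h) :
    IsClosed {q : E × E | q.2 ∈ subdifferential h q.1} := by
  have hinter : {q : E × E | q.2 ∈ subdifferential h q.1} =
      ⋂ y, {q : E × E | h q.1 + inner ℝ q.2 (y - q.1) ≤ h y} := by
    ext
    simp [subdifferential]
  rw [hinter]
  exact isClosed_iInter fun y => isClosed_le (by fun_prop) continuous_const

theorem norm_le_of_mem_subdifferential {K : ℝ≥0} (hK : LipschitzWith K h) {x s : E}
    (hs : s ∈ subdifferential h x) : ‖s‖ ≤ K := by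
  have hsub : h x + ‖s‖ * ‖s‖ ≤ h (x + s) := by
    simpa [← sq] using hs (x + s)
  have hlip : h (x + s) - h x ≤ K * ‖s‖ := by
    simpa [Real.dist_eq] using (le_abs_self _).trans (hK.dist_le_mul (x + s) x)
  rcases (norm_nonneg s).eq_or_lt with hs0 | hs0
  · exact hs0 ▸ K.2
  · exact le_of_mul_le_mul_right (by linarith) hs0

theorem isCompact_biUnion_subdifferential [FiniteDimensional ℝ E] {K : ℝ≥0}
    (hh : LipschitzWith K h) {Z : Set E} (hZ : IsCompact Z) :
    IsCompact (⋃ z ∈ Z, subdifferential h z) := by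
  have hclosed : IsClosed {s | ∃ z ∈ Z, (s, z) ∈ {q : E × E | q.1 ∈ subdifferential h q.2}} :=
    isClosed_setOf_exists_mem_of_isCompact hZ
      ((isClosed_setOf_mem_subdifferential hh.continuous).preimage continuous_swap)
  refine (isCompact_closedBall (0 : E) K).of_isClosed_subset
    (by convert hclosed using 1; ext; simp) (iUnion₂_subset fun z _ s hs => ?_)
  simpa using norm_le_of_mem_subdifferential hh hs

theorem mem_subdifferential_of_hasGradientAt [CompleteSpace E] (hh : ConvexOn ℝ univ h) {x s : E}
    (hs : HasGradientAt h s x) : s ∈ subdifferential h x := by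
  intro y
  have hline : HasDerivAt (h ∘ AffineMap.lineMap x y) (inner ℝ s (y - x)) (0 : ℝ) := by
    have hs' : HasFDerivAt h (InnerProductSpace.toDual ℝ E s) (AffineMap.lineMap x y (0 : ℝ)) := by
      simpa using hs.hasFDerivAt
    simpa using hs'.comp_hasDerivAt (0 : ℝ) AffineMap.hasDerivAt_lineMap
  have hslope := (hh.comp_affineMap (AffineMap.lineMap x y)).le_slope_of_hasDerivAt
    (mem_univ (0 : ℝ)) (mem_univ 1) one_pos hline
  have : inner ℝ s (y - x) ≤ h y - h x := by simpa [slope_def_field] using hslope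
  linarith

end Subdifferential

namespace IsSublinear

variable {m : ℕ} {h : Euc m → ℝ}

theorem convexOn (hh : IsSublinear h) : ConvexOn ℝ univ h :=
  convexOn_iff_convex_epigraph.2 (by simpa [epigraph] using hh.convex)

theorem continuous (hh : IsSublinear h) : Continuous h :=
  continuousOn_univ.1 (hh.convexOn.continuousOn isOpen_univ)

theorem map_smul_of_pos (hh : IsSublinear h) {r : ℝ} (hr : 0 < r) (y : Euc m) :
    h (r • y) = r * h y := by
  have hle : ∀ {t : ℝ}, 0 < t → ∀ z, h (t • z) ≤ t * h z := fun ht z =>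
    hh.cone _ ht (z, h z) (le_refl (h z))
  refine le_antisymm (hle hr y) ?_
  have hinv := hle (inv_pos.2 hr) (r • y)
  rwa [inv_smul_smul₀ hr.ne', le_inv_mul_iff₀ hr] at hinv

theorem map_zero (hh : IsSublinear h) : h 0 = 0 := by
  have := hh.map_smul_of_pos two_pos 0
  rw [smul_zero] at this
  linarith

theorem map_smul_of_nonneg (hh : IsSublinear h) {r : ℝ} (hr : 0 ≤ r) (y : Euc m) :
    h (r • y) = r * h y := by
  rcases hr.eq_or_lt with rfl | hr
  · simp [hh.map_zero]
  · exact hh.map_smul_of_pos hr y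

theorem map_add_le (hh : IsSublinear h) (y z : Euc m) : h (y + z) ≤ h y + h z := by
  have hmid := hh.convexOn.2 (mem_univ y) (mem_univ z)
    (by norm_num : (0 : ℝ) ≤ 1 / 2) (by norm_num : (0 : ℝ) ≤ 1 / 2) (by norm_num)
  rw [← smul_add, hh.map_smul_of_pos (by norm_num), smul_eq_mul, smul_eq_mul] at hmid
  linarith

theorem neg_map_neg_le (hh : IsSublinear h) (y : Euc m) : -h (-y) ≤ h y := by
  have := hh.map_add_le y (-y)
  rw [add_neg_cancel, hh.map_zero] at this
  linarith

theorem exists_lipschitzWith (hh : IsSublinear h) : ∃ K : ℝ≥0, LipschitzWith K h := by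
  obtain ⟨K, hK⟩ := (isCompact_sphere (0 : Euc m) 1).exists_bound_of_continuousOn
    hh.continuous.continuousOn
  have hbound : ∀ y, h y ≤ K.toNNReal * ‖y‖ := by
    intro y
    rcases eq_or_ne y 0 with rfl | hy
    · simp [hh.map_zero]
    have hunit := hK (‖y‖⁻¹ • y) (by simp [norm_smul, hy])
    calc h y = ‖y‖ * h (‖y‖⁻¹ • y) := by
          rw [← hh.map_smul_of_nonneg (norm_nonneg y), smul_inv_smul₀ (norm_ne_zero_iff.2 hy)]
      _ ≤ ‖y‖ * K.toNNReal := by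
          gcongr
          exact (le_abs_self _).trans (hunit.trans (Real.le_coe_toNNReal K))
      _ = K.toNNReal * ‖y‖ := mul_comm _ _
  refine ⟨K.toNNReal, LipschitzWith.of_le_add_mul _ fun x y => ?_⟩
  have hadd := hh.map_add_le y (x - y)
  rw [add_sub_cancel] at hadd
  rw [dist_eq_norm]
  linarith [hbound (x - y)]

theorem dense_setOf_differentiableAt (hh : IsSublinear h) : Dense {z | DifferentiableAt ℝ h z} :=
  let ⟨_, hK⟩ := hh.exists_lipschitzWith
  MeasureTheory.Measure.dense_of_ae (hK.ae_differentiableAt (μ := MeasureTheory.volume))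

theorem map_add_of_mem_lineality (hh : IsSublinear h) (y : Euc m) {l : Euc m}
    (hl : l ∈ lineality h) : h (y + l) = h y + h l := by
  refine le_antisymm (hh.map_add_le y l) ?_
  have hback := hh.map_add_le (y + l) (-l)
  rw [add_neg_cancel_right] at hback
  have hl' : h l = -h (-l) := hl
  linarith

theorem mem_lineality_of_map_le_neg_map_neg (hh : IsSublinear h) {y : Euc m}
    (hy : h y ≤ -h (-y)) : y ∈ lineality h :=
  le_antisymm hy (hh.neg_map_neg_le y)

/-- The lineality space of a sublinear function as a linear subspace. -/
def linealitySubmodule (hh : IsSublinear h) : Submodule ℝ (Euc m) where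
  carrier := lineality h
  zero_mem' := by simp [lineality, hh.map_zero]
  add_mem' {y l} hy hl := by
    have hy' : h y = -h (-y) := hy
    have hl' : h l = -h (-l) := hl
    refine hh.mem_lineality_of_map_le_neg_map_neg ?_
    rw [neg_add]
    linarith [hh.map_add_le y l, hh.map_add_le (-y) (-l)]
  smul_mem' r y hy := by
    have hy' : h y = -h (-y) := hy
    change h (r • y) = -h (-(r • y))
    rcases le_total 0 r with hr | hr
    · rw [← smul_neg, hh.map_smul_of_nonneg hr, hh.map_smul_of_nonneg hr, hy']
      ring
    · rw [← neg_smul, hh.map_smul_of_nonneg (neg_nonneg.2 hr), ← neg_smul_neg,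
        hh.map_smul_of_nonneg (neg_nonneg.2 hr), hy']
      ring

theorem mem_subdifferential_iff (hh : IsSublinear h) {x s : Euc m} :
    s ∈ subdifferential h x ↔ (∀ y, inner ℝ s y ≤ h y) ∧ inner ℝ s x = h x := by
  refine ⟨fun hs => ?_, fun ⟨hle, hx⟩ y => ?_⟩
  · have hle : ∀ y, inner ℝ s y ≤ h y := fun y => by
      have := hs (x + y)
      rw [add_sub_cancel_left] at this
      linarith [hh.map_add_le x y]
    refine ⟨hle, le_antisymm (hle x) ?_⟩
    have := hs 0
    rw [zero_sub, inner_neg_right, hh.map_zero] at this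
    linarith
  · rw [inner_sub_right, hx]
    linarith [hle y]

theorem subdifferential_subset_zero (hh : IsSublinear h) (x : Euc m) :
    subdifferential h x ⊆ subdifferential h 0 := fun _ hs =>
  hh.mem_subdifferential_iff.2
    ⟨(hh.mem_subdifferential_iff.1 hs).1, by rw [inner_zero_right, hh.map_zero]⟩

theorem inner_eq_of_mem_lineality (hh : IsSublinear h) {x s l : Euc m}
    (hs : s ∈ subdifferential h x) (hl : l ∈ lineality h) : inner ℝ s l = h l := by
  have hle := (hh.mem_subdifferential_iff.1 hs).1
  refine le_antisymm (hle l) ?_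
  have hneg := hle (-l)
  rw [inner_neg_right] at hneg
  have hl' : h l = -h (-l) := hl
  linarith

theorem subdifferential_smul (hh : IsSublinear h) {r : ℝ} (hr : 0 < r) (x : Euc m) :
    subdifferential h (r • x) = subdifferential h x := by
  ext s
  simp only [hh.mem_subdifferential_iff, hh.map_smul_of_pos hr, real_inner_smul_right,
    mul_right_inj' hr.ne']

theorem subdifferential_add_of_mem_lineality (hh : IsSublinear h) (x : Euc m) {l : Euc m}
    (hl : l ∈ lineality h) : subdifferential h (x + l) = subdifferential h x := by
  ext s
  simp only [hh.mem_subdifferential_iff]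
  refine and_congr_right fun hle => ?_
  have hs : s ∈ subdifferential h 0 :=
    hh.mem_subdifferential_iff.2 ⟨hle, by rw [inner_zero_right, hh.map_zero]⟩
  rw [inner_add_right, hh.inner_eq_of_mem_lineality hs hl, hh.map_add_of_mem_lineality x hl,
    add_left_inj]

theorem hasGradientAt_smul_add (hh : IsSublinear h) {z s l : Euc m} (hs : HasGradientAt h s z)
    {r : ℝ} (hr : 0 < r) (hl : l ∈ lineality h) : HasGradientAt h s (r • z + l) := by
  have hscale : ∀ y, h y = r * h (r⁻¹ • (y - l)) + h l := fun y => by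
    rw [← hh.map_smul_of_pos hr, smul_inv_smul₀ hr.ne', ← hh.map_add_of_mem_lineality _ hl,
      sub_add_cancel]
  have hz : r⁻¹ • (r • z + l - l) = z := by rw [add_sub_cancel_right, inv_smul_smul₀ hr.ne']
  have hs' : HasFDerivAt h (InnerProductSpace.toDual ℝ (Euc m) s) (r⁻¹ • (r • z + l - l)) :=
    hz.symm ▸ hs.hasFDerivAt
  have hinner : HasFDerivAt (fun y => r⁻¹ • (y - l)) (r⁻¹ • ContinuousLinearMap.id ℝ (Euc m))
      (r • z + l) := ((hasFDerivAt_id _).sub_const l).fun_const_smul r⁻¹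
  rw [hasGradientAt_iff_hasFDerivAt, funext hscale]
  refine (((hs'.comp (r • z + l) hinner).const_mul r).add_const (h l)).congr_fderiv ?_
  ext w
  simp [hr.ne']

theorem exists_mem_subdifferential_inner_comp_eq (hh : IsSublinear h) {X : Type*} [AddCommGroup X]
    [Module ℝ X] (T : X →ₗ[ℝ] Euc m) {φ : X →ₗ[ℝ] ℝ} (hφ : ∀ x, φ x ≤ h (T x)) :
    ∃ s ∈ subdifferential h 0, ∀ x, inner ℝ s (T x) = φ x := by
  obtain ⟨g, rfl, hg⟩ := exists_comp_eq_of_le_sublinear_comp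
    (fun _ hr => hh.map_smul_of_pos hr) hh.map_add_le T hφ
  refine ⟨(InnerProductSpace.toDual ℝ (Euc m)).symm (LinearMap.toContinuousLinearMap g),
    hh.mem_subdifferential_iff.2 ⟨fun y => ?_, ?_⟩, fun x => ?_⟩
  · simpa using hg y
  · rw [inner_zero_right, hh.map_zero]
  · simp

theorem nonempty_subdifferential_zero (hh : IsSublinear h) : (subdifferential h 0).Nonempty :=
  let ⟨s, hs, _⟩ := hh.exists_mem_subdifferential_inner_comp_eq (0 : Euc m →ₗ[ℝ] Euc m) (φ := 0)
    fun _ => hh.map_zero.ge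
  ⟨s, hs⟩

theorem subdifferential_subset_biUnion_orthogonal_sphere (hh : IsSublinear h) {y : Euc m}
    (hy : y ∉ lineality h) :
    subdifferential h y ⊆
      ⋃ q ∈ (hh.linealitySubmoduleᗮ : Set (Euc m)) ∩ Metric.sphere 0 1, subdifferential h q := by
  obtain ⟨l, hl, q, hq, rfl⟩ := hh.linealitySubmodule.exists_add_mem_mem_orthogonal y
  have hq0 : q ≠ 0 := by
    rintro rfl
    exact hy (by rwa [add_zero])
  intro s hs
  rw [add_comm, hh.subdifferential_add_of_mem_lineality q hl] at hs
  refine mem_iUnion₂.2 ⟨‖q‖⁻¹ • q, ⟨Submodule.smul_mem _ _ hq, by simp [norm_smul, hq0]⟩, ?_⟩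
  rwa [hh.subdifferential_smul (inv_pos.2 (norm_pos_iff.2 hq0))]

end IsSublinear

section Calculus

variable {E F : Type*} [NormedAddCommGroup E] [NormedSpace ℝ E] [NormedAddCommGroup F]
  [NormedSpace ℝ F] {c : E → F}

theorem exists_lipschitzOnWith_fderiv_ball (hc : ContDiff ℝ 2 c) (x : E) :
    ∃ (C : ℝ≥0), ∃ r > 0, LipschitzOnWith C (fderiv ℝ c) (Metric.ball x r) := by
  obtain ⟨C, t, ht, hC⟩ := (hc.fderiv_right (m := 1) (by norm_num)).contDiffAt (x := x)
    |>.exists_lipschitzOnWith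
  obtain ⟨r, hr, hrt⟩ := Metric.mem_nhds_iff.1 ht
  exact ⟨C, r, hr, hC.mono hrt⟩

theorem norm_sub_sub_fderiv_le_of_lipschitzOnWith {C : ℝ≥0} {S : Set E} (hS : Convex ℝ S)
    (hc : ∀ x ∈ S, DifferentiableAt ℝ c x) (hC : LipschitzOnWith C (fderiv ℝ c) S) {y z : E}
    (hy : y ∈ S) (hz : z ∈ S) : ‖c y - c z - fderiv ℝ c z (y - z)‖ ≤ C * ‖y - z‖ ^ 2 := by
  have hseg := hS.segment_subset hz hy
  rw [sq, ← mul_assoc]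
  refine (convex_segment z y).norm_image_sub_le_of_norm_fderiv_le' (𝕜 := ℝ)
    (fun w hw => hc w (hseg hw)) (fun w hw => ?_) (left_mem_segment ℝ z y)
    (right_mem_segment ℝ z y)
  calc ‖fderiv ℝ c w - fderiv ℝ c z‖ ≤ C * ‖w - z‖ := hC.norm_sub_le (hseg hw) hz
    _ ≤ C * ‖y - z‖ := by gcongr; exact norm_sub_le_of_mem_segment hw

end Calculus

section AdjointChainRule

variable {E F : Type*} [NormedAddCommGroup E] [InnerProductSpace ℝ E] [CompleteSpace E]
  [NormedAddCommGroup F] [InnerProductSpace ℝ F] [CompleteSpace F] {c : E → F}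

theorem hasGradientAt_const_add_comp {h : F → ℝ} {A : E →L[ℝ] F} {u : E} {s : F}
    (hh : HasGradientAt h s (c u)) (hc : HasFDerivAt c A u) (a : ℝ) :
    HasGradientAt (fun z => a + h (c z)) (adjoint A s) u := by
  rw [hasGradientAt_iff_hasFDerivAt]
  refine ((hh.hasFDerivAt.comp u hc).const_add a).congr_fderiv ?_
  ext w
  simp [ContinuousLinearMap.adjoint_inner_left]

theorem continuous_adjoint_fderiv_apply (hc : ContDiff ℝ 1 c) :
    Continuous fun p : E × F => adjoint (fderiv ℝ c p.1) p.2 := by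
  have hadj : Continuous fun u => adjoint (fderiv ℝ c u) :=
    (LinearIsometryEquiv.continuous adjoint).comp (hc.continuous_fderiv one_ne_zero)
  exact (hadj.comp continuous_fst).clm_apply continuous_snd

end AdjointChainRule

section CompactMinimum

variable {X Y : Type*} [TopologicalSpace X] [TopologicalSpace Y]

theorem exists_pos_eventually_forall_le_of_isCompact {K : Set Y} (hK : IsCompact K) {g : X × Y → ℝ}
    (hg : Continuous g) {x : X} (hpos : ∀ y ∈ K, 0 < g (x, y)) :
    ∃ μ > 0, ∀ᶠ x' in 𝓝 x, ∀ y ∈ K, μ ≤ g (x', y) := by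
  obtain ⟨μ, hμ, hμ_le⟩ := hK.exists_forall_le' (f := fun y => g (x, y))
    (hg.comp (.prodMk_right x)).continuousOn hpos
  refine ⟨μ / 2, half_pos hμ, hK.eventually_forall_of_forall_eventually fun y hy => ?_⟩
  exact (hg.tendsto (x, y)).eventually_const_le ((half_lt_self hμ).trans_le (hμ_le y hy))

end CompactMinimum

section Transversality

variable {E F : Type*} [NormedAddCommGroup E] [NormedSpace ℝ E] [NormedAddCommGroup F]
  [NormedSpace ℝ F] {c : E → F} {L : Submodule ℝ F} {x : E}

theorem isOpen_setOf_surjective [FiniteDimensional ℝ F] :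
    IsOpen {A : E →L[ℝ] F | Function.Surjective A} := by
  convert isOpen_setOfPred_nat_le_rank (𝕜 := ℝ) (E := E) (F := F) (Module.finrank ℝ F) using 1
  ext A
  change Function.Surjective A.toLinearMap ↔ _
  rw [mem_ofPred_eq, LinearMap.rank, ← LinearMap.range_eq_top, ← Module.finrank_eq_rank ℝ,
    Nat.cast_le]
  refine ⟨fun hA => ?_, fun hA => ?_⟩
  · rw [hA, finrank_top]
  · exact Submodule.eq_top_of_finrank_eq (le_antisymm (Submodule.finrank_le _) hA)

/-- Transversality of the map `c` at `x` to a linear subspace `L` of its target; `x` is not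
required to lie in `c ⁻¹' L`. -/
def IsTransverseAt (c : E → F) (L : Submodule ℝ F) (x : E) : Prop :=
  L ⊔ LinearMap.range (fderiv ℝ c x).toLinearMap = ⊤

namespace IsTransverseAt

theorem exists_add_fderiv_eq (hL : IsTransverseAt c L x) (y : F) :
    ∃ l ∈ L, ∃ w, l + fderiv ℝ c x w = y := by
  have hy : y ∈ L ⊔ LinearMap.range (fderiv ℝ c x).toLinearMap := hL ▸ Submodule.mem_top
  obtain ⟨l, hl, _, ⟨w, rfl⟩, rfl⟩ := Submodule.mem_sup.1 hy
  exact ⟨l, hl, w, rfl⟩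

theorem eventually_exists_sub_mem [CompleteSpace E] [CompleteSpace F] [CompleteSpace L]
    (hL : IsTransverseAt c L x) (hc : ContDiffAt ℝ 1 c x) {V : Set E} (hV : V ∈ 𝓝 x) :
    ∀ᶠ y in 𝓝 (c x), ∃ u ∈ V, c u - y ∈ L := by
  have hderiv : HasStrictFDerivAt (fun q : E × L => c q.1 + q.2)
      ((fderiv ℝ c x).coprod L.subtypeL) (x, 0) :=
    ((hc.hasStrictFDerivAt one_ne_zero).comp (x, (0 : L)) hasStrictFDerivAt_fst).add
      (L.subtypeL.hasStrictFDerivAt.comp (x, (0 : L)) hasStrictFDerivAt_snd)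
      |>.congr_fderiv (by ext <;> simp)
  have hsurj : LinearMap.range ((fderiv ℝ c x).coprod L.subtypeL).toLinearMap = ⊤ := by
    refine LinearMap.range_eq_top.2 fun y => ?_
    obtain ⟨l, hl, w, rfl⟩ := hL.exists_add_fderiv_eq y
    exact ⟨(w, ⟨l, hl⟩), by simp [add_comm]⟩
  have himage := image_mem_map (m := fun q : E × L => c q.1 + q.2)
    (prod_mem_nhds hV (univ_mem (f := 𝓝 (0 : L))))
  rw [hderiv.map_nhds_eq_of_surj hsurj] at himage
  rw [Submodule.coe_zero, add_zero] at himage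
  filter_upwards [himage]
  rintro _ ⟨⟨u, l⟩, ⟨hu, -⟩, rfl⟩
  exact ⟨u, hu, by simp⟩

end IsTransverseAt

end Transversality

section ManifoldPreimage

variable {d m : ℕ}

theorem exists_surjective_ker_eq (L : Submodule ℝ (Euc m)) :
    ∃ (k : ℕ) (Q : Euc m →L[ℝ] Euc k), Function.Surjective Q ∧ ∀ y, Q y = 0 ↔ y ∈ L := by
  refine ⟨_, (stdOrthonormalBasis ℝ Lᗮ).repr.toContinuousLinearEquiv.toContinuousLinearMap ∘L
    Lᗮ.orthogonalProjectionOnto, ?_, fun y => by simp⟩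
  exact (stdOrthonormalBasis ℝ Lᗮ).repr.surjective.comp fun z =>
    ⟨z, Submodule.orthogonalProjectionOnto_mem_subspace_eq_self z⟩

theorem IsManifoldAround.eventually {p : ℕ} {M : Set (Euc d)} {x : Euc d}
    (hM : IsManifoldAround p M x) : ∀ᶠ y in 𝓝 x, IsManifoldAround p M y := by
  obtain ⟨k, U, F, hF⟩ := hM
  filter_upwards [hF.isOpen.mem_nhds hF.mem] with y hy
  exact ⟨k, U, F, hF.isOpen, hy, hF.smooth, hF.surjective, hF.zero_set⟩

theorem IsTransverseAt.isManifoldAround_preimage {c : Euc d → Euc m} {L : Submodule ℝ (Euc m)}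
    {x : Euc d} (hL : IsTransverseAt c L x) {p : ℕ} (hp : p ≠ 0) (hc : ContDiff ℝ p c) :
    IsManifoldAround p (c ⁻¹' L) x := by
  have hp' : (p : WithTop ℕ∞) ≠ 0 := by exact_mod_cast hp
  obtain ⟨k, Q, hQ_surj, hQ⟩ := exists_surjective_ker_eq L
  have hfderiv (z : Euc d) : fderiv ℝ (Q ∘ c) z = Q ∘L fderiv ℝ c z :=
    (Q.hasFDerivAt.comp z (hc.differentiable hp' z).hasFDerivAt).fderiv
  have hcont : Continuous fun z => Q ∘L fderiv ℝ c z := by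
    have := hc.continuous_fderiv hp'
    fun_prop
  refine ⟨k, {z | Function.Surjective (Q ∘L fderiv ℝ c z)}, Q ∘ c,
    isOpen_setOf_surjective.preimage hcont, fun z => ?_, (Q.contDiff.comp hc).contDiffOn,
    fun z hz => (hfderiv z).symm ▸ hz, ?_⟩
  · obtain ⟨y, rfl⟩ := hQ_surj z
    obtain ⟨l, hl, w, rfl⟩ := hL.exists_add_fderiv_eq y
    exact ⟨w, by simp [(hQ l).2 hl]⟩
  · ext z
    rw [mem_inter_iff, and_comm]
    exact and_congr_right fun _ => (hQ (c z)).symm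

end ManifoldPreimage

section ChainRule

variable {d m : ℕ} {f : Euc d → ℝ} {h : Euc m → ℝ} {c : Euc d → Euc m} {a : ℝ} {x : Euc d}

theorem IsSublinear.fderiv_add_mul_le (hh : IsSublinear h)
    (hfc : f =ᶠ[𝓝 x] fun z => a + h (c z)) (hf : DifferentiableAt ℝ f x)
    (hc : DifferentiableAt ℝ c x) (w : Euc d) (r : ℝ) :
    fderiv ℝ f x w + r * h (c x) ≤ h (fderiv ℝ c x w + r • c x) := by
  have hline : Tendsto (fun t : ℝ => x + t⁻¹ • w) atTop (𝓝 x) := by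
    simpa using ((tendsto_inv_atTop_zero (𝕜 := ℝ)).smul_const w).const_add x
  have hleft : Tendsto (fun t : ℝ => t • (f (x + t⁻¹ • w) - f x) + r * h (c x)) atTop
      (𝓝 (fderiv ℝ f x w + r * h (c x))) := (hf.hasFDerivAt.lim_real w).add_const _
  have hright : Tendsto (fun t : ℝ => h (t • (c (x + t⁻¹ • w) - c x) + r • c x)) atTop
      (𝓝 (h (fderiv ℝ c x w + r • c x))) :=
    (hh.continuous.tendsto _).comp ((hc.hasFDerivAt.lim_real w).add_const _)
  refine le_of_tendsto_of_tendsto hleft hright ?_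
  filter_upwards [hline.eventually hfc, eventually_gt_atTop 0, eventually_ge_atTop r]
    with t ht ht_pos hrt
  have hsplit : t • c (x + t⁻¹ • w) =
      (t - r) • c x + (t • (c (x + t⁻¹ • w) - c x) + r • c x) := by module
  have hsub := hh.map_add_le ((t - r) • c x) (t • (c (x + t⁻¹ • w) - c x) + r • c x)
  rw [← hsplit, hh.map_smul_of_pos ht_pos, hh.map_smul_of_nonneg (sub_nonneg.2 hrt)] at hsub
  rw [ht, hfc.self_of_nhds, smul_eq_mul]
  linarith

theorem IsSublinear.exists_mem_subdifferential_adjoint_eq_gradient (hh : IsSublinear h)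
    (hfc : f =ᶠ[𝓝 x] fun z => a + h (c z)) (hf : DifferentiableAt ℝ f x)
    (hc : DifferentiableAt ℝ c x) :
    ∃ s ∈ subdifferential h (c x), adjoint (fderiv ℝ c x) s = gradient f x := by
  -- The extra direction `c x` in the range of `T` forces `⟪s, c x⟫ = h (c x)`.
  let T : (Euc d × ℝ) →ₗ[ℝ] Euc m :=
    (fderiv ℝ c x).toLinearMap.coprod (LinearMap.toSpanSingleton ℝ (Euc m) (c x))
  let φ : (Euc d × ℝ) →ₗ[ℝ] ℝ :=
    (fderiv ℝ f x).toLinearMap.coprod (LinearMap.toSpanSingleton ℝ ℝ (h (c x)))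
  obtain ⟨s, hs, hsT⟩ := hh.exists_mem_subdifferential_inner_comp_eq T (φ := φ) fun ⟨w, r⟩ => by
    simpa [T, φ] using hh.fderiv_add_mul_le hfc hf hc w r
  refine ⟨s, hh.mem_subdifferential_iff.2 ⟨(hh.mem_subdifferential_iff.1 hs).1, ?_⟩, ?_⟩
  · simpa [T, φ] using hsT (0, 1)
  · refine ext_inner_right ℝ fun w => ?_
    rw [ContinuousLinearMap.adjoint_inner_left, inner_gradient_left]
    simpa [T, φ] using hsT (w, 0)

theorem IsSublinear.isClosed_setOf_mem_adjoint_image_subdifferential (hh : IsSublinear h)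
    (hc : ContDiff ℝ 1 c) :
    IsClosed {p : Euc d × Euc d | p.2 ∈ adjoint (fderiv ℝ c p.1) '' subdifferential h (c p.1)} := by
  obtain ⟨K, hK⟩ := hh.exists_lipschitzWith
  have hsub : IsClosed {q : (Euc d × Euc d) × Euc m | q.2 ∈ subdifferential h (c q.1.1)} :=
    (isClosed_setOf_mem_subdifferential hh.continuous).preimage
      (f := fun q : (Euc d × Euc d) × Euc m => (c q.1.1, q.2)) (by fun_prop)
  have hadj : IsClosed {q : (Euc d × Euc d) × Euc m | adjoint (fderiv ℝ c q.1.1) q.2 = q.1.2} :=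
    isClosed_eq ((continuous_adjoint_fderiv_apply hc).comp
      (f := fun q : (Euc d × Euc d) × Euc m => (q.1.1, q.2)) (by fun_prop)) (by fun_prop)
  have hproj := isClosed_setOf_exists_mem_of_isCompact (isCompact_closedBall (0 : Euc m) K)
    (hsub.inter hadj)
  refine (congrArg IsClosed (Set.ext fun p => exists_congr fun s => ?_)).mp hproj
  refine and_iff_right_of_imp fun hs => ?_
  simpa using norm_le_of_mem_subdifferential hK hs.1

theorem IsSublinear.clarkeSubdifferential_subset (hh : IsSublinear h) (hc : ContDiff ℝ 1 c)
    (hfc : f =ᶠ[𝓝 x] fun z => a + h (c z)) :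
    clarkeSubdifferential f x ⊆ adjoint (fderiv ℝ c x) '' subdifferential h (c x) := by
  refine convexHull_min ?_ ((convex_subdifferential h (c x)).is_linear_image
    (adjoint (fderiv ℝ c x)).toLinearMap.isLinear)
  rintro v ⟨u, hu_diff, hu, hgrad⟩
  refine (hh.isClosed_setOf_mem_adjoint_image_subdifferential hc).mem_of_tendsto
    (hu.prodMk_nhds hgrad) ?_
  filter_upwards [hu.eventually hfc.eventually_nhds] with n hn
  exact hh.exists_mem_subdifferential_adjoint_eq_gradient hn (hu_diff n)
    (hc.differentiable one_ne_zero _)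

end ChainRule

namespace IsProperlyDecomposableAs

variable {d m p : ℕ} {f : Euc d → ℝ} {xbar : Euc d} {h : Euc m → ℝ} {c : Euc d → Euc m}

theorem contDiff_one (hdec : IsProperlyDecomposableAs p f xbar h c) (hp : p ≠ 0) :
    ContDiff ℝ 1 c :=
  hdec.smooth.of_le (by exact_mod_cast Nat.one_le_iff_ne_zero.2 hp)

theorem isTransverseAt (hdec : IsProperlyDecomposableAs p f xbar h c) :
    IsTransverseAt c hdec.sublinear.linealitySubmodule xbar :=
  SetLike.coe_injective <| (Submodule.coe_sup _ _).trans hdec.transversality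

theorem mem_preimage_lineality (hdec : IsProperlyDecomposableAs p f xbar h c) :
    xbar ∈ c ⁻¹' lineality h := by
  rw [mem_preimage, hdec.map_base]
  exact hdec.sublinear.linealitySubmodule.zero_mem

theorem eventually_clarkeSubdifferential_subset (hdec : IsProperlyDecomposableAs p f xbar h c)
    (hp : p ≠ 0) : ∀ᶠ x in 𝓝 xbar,
      clarkeSubdifferential f x ⊆ adjoint (fderiv ℝ c x) '' subdifferential h (c x) :=
  hdec.decomp.eventually_nhds.mono fun _ =>
    hdec.sublinear.clarkeSubdifferential_subset (hdec.contDiff_one hp)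

theorem exists_mem_exists_pos_sub_smul_mem_lineality
    (hdec : IsProperlyDecomposableAs p f xbar h c) (hp : p ≠ 0) {V : Set (Euc d)}
    (hV : V ∈ 𝓝 xbar) (z : Euc m) :
    ∃ u ∈ V, ∃ t > (0 : ℝ), c u - t • z ∈ lineality h := by
  have hscale : Tendsto (fun t : ℝ => t • z) (𝓝[>] 0) (𝓝 (c xbar)) := by
    rw [hdec.map_base]
    exact (Continuous.tendsto' (by fun_prop) 0 0 (zero_smul ℝ z)).mono_left nhdsWithin_le_nhds
  have hsolve := hscale.eventually <|
    hdec.isTransverseAt.eventually_exists_sub_mem (hdec.contDiff_one hp).contDiffAt hV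
  obtain ⟨t, ⟨u, hu, hut⟩, ht⟩ := (hsolve.and self_mem_nhdsWithin).exists
  exact ⟨u, hu, t, ht, hut⟩

theorem mem_closure_setOf_hasGradientAt (hdec : IsProperlyDecomposableAs p f xbar h c)
    (hp : p ≠ 0) {z s : Euc m} (hs : HasGradientAt h s z) :
    xbar ∈ closure {u | HasGradientAt f (adjoint (fderiv ℝ c u) s) u} := by
  refine mem_closure_iff_nhds.2 fun V hV => ?_
  obtain ⟨u, ⟨huV, hfu⟩, t, ht, hut⟩ :=
    hdec.exists_mem_exists_pos_sub_smul_mem_lineality hp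
      (inter_mem hV hdec.decomp.eventually_nhds) z
  have hgrad : HasGradientAt h s (c u) := by
    simpa only [add_sub_cancel] using hdec.sublinear.hasGradientAt_smul_add hs ht hut
  have hgrad_comp : HasGradientAt (fun x => f xbar + h (c x)) (adjoint (fderiv ℝ c u) s) u :=
    hasGradientAt_const_add_comp hgrad
      ((hdec.contDiff_one hp).differentiable one_ne_zero u).hasFDerivAt _
  have hgrad_f : HasGradientAt f (adjoint (fderiv ℝ c u) s) u :=
    hgrad_comp.congr_of_eventuallyEq hfu
  exact ⟨u, huV, hgrad_f⟩

theorem adjoint_mem_clarkeSubdifferential (hdec : IsProperlyDecomposableAs p f xbar h c)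
    (hp : p ≠ 0) {z s : Euc m} (hs : HasGradientAt h s z) :
    adjoint (fderiv ℝ c xbar) s ∈ clarkeSubdifferential f xbar := by
  obtain ⟨u, hu_grad, hu⟩ :=
    mem_closure_iff_seq_limit.1 (hdec.mem_closure_setOf_hasGradientAt hp hs)
  have hgrad (n : ℕ) : HasGradientAt f (adjoint (fderiv ℝ c (u n)) s) (u n) := hu_grad n
  have hcont : Continuous fun u => adjoint (fderiv ℝ c u) s :=
    (continuous_adjoint_fderiv_apply (hdec.contDiff_one hp)).comp
      (f := fun u : Euc d => (u, s)) (by fun_prop)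
  refine subset_convexHull ℝ _ ⟨u, fun n => (hgrad n).differentiableAt, hu, ?_⟩
  rw [funext fun n => (hgrad n).gradient]
  exact (hcont.tendsto xbar).comp hu

theorem inner_eq_zero_of_map_le_zero (hdec : IsProperlyDecomposableAs p f xbar h c) (hp : p ≠ 0)
    (hsc : StrictComplementarity f xbar) {w : Euc d} (hw : h (fderiv ℝ c xbar w) ≤ 0) {v : Euc d}
    (hv : v ∈ clarkeSubdifferential f xbar) : inner ℝ w v = 0 := by
  have hmax : IsMaxOn (innerₛₗ ℝ w) (clarkeSubdifferential f xbar) 0 := by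
    intro v' hv'
    obtain ⟨s, hs, rfl⟩ := (hdec.eventually_clarkeSubdifferential_subset hp).self_of_nhds hv'
    simpa [ContinuousLinearMap.adjoint_inner_right, real_inner_comm] using
      ((hdec.sublinear.mem_subdifferential_iff.1 hs).1 _).trans hw
  simpa using eq_of_isMaxOn_of_mem_intrinsicInterior hmax hsc hv

theorem fderiv_mem_lineality_of_map_le_zero (hdec : IsProperlyDecomposableAs p f xbar h c)
    (hp : p ≠ 0) (hsc : StrictComplementarity f xbar) {w : Euc d}
    (hw : h (fderiv ℝ c xbar w) ≤ 0) : fderiv ℝ c xbar w ∈ lineality h := by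
  have hh := hdec.sublinear
  have hmono_diff : ∀ z, DifferentiableAt ℝ h z → h z ≤ h (z + fderiv ℝ c xbar w) := by
    intro z hz
    obtain ⟨hle, hz_eq⟩ := hh.mem_subdifferential_iff.1
      (mem_subdifferential_of_hasGradientAt hh.convexOn hz.hasGradientAt)
    have horth := hdec.inner_eq_zero_of_map_le_zero hp hsc hw
      (hdec.adjoint_mem_clarkeSubdifferential hp hz.hasGradientAt)
    rw [ContinuousLinearMap.adjoint_inner_right, real_inner_comm] at horth
    have := hle (z + fderiv ℝ c xbar w)
    rwa [inner_add_right, horth, add_zero, hz_eq] at this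
  have hmono : ∀ z, h z ≤ h (z + fderiv ℝ c xbar w) := by
    have hclosed : IsClosed {z | h z ≤ h (z + fderiv ℝ c xbar w)} :=
      isClosed_le hh.continuous (hh.continuous.comp (continuous_add_const _))
    exact fun z => hclosed.closure_subset_iff.2 hmono_diff (hh.dense_setOf_differentiableAt z)
  have hneg := hmono (-fderiv ℝ c xbar w)
  rw [neg_add_cancel, hh.map_zero] at hneg
  exact hh.mem_lineality_of_map_le_neg_map_neg (by linarith)

theorem adjoint_fderiv_ne_zero (hdec : IsProperlyDecomposableAs p f xbar h c) (hp : p ≠ 0)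
    (hsc : StrictComplementarity f xbar) {q s : Euc m} (hq : q ∉ lineality h)
    (hs : s ∈ subdifferential h q) : adjoint (fderiv ℝ c xbar) s ≠ 0 := by
  intro hzero
  have hh := hdec.sublinear
  obtain ⟨l, hl, w, rfl⟩ := hdec.isTransverseAt.exists_add_fderiv_eq q
  rw [add_comm, hh.subdifferential_add_of_mem_lineality _ hl] at hs
  have hw : h (fderiv ℝ c xbar w) = 0 := by
    rw [← (hh.mem_subdifferential_iff.1 hs).2, ← ContinuousLinearMap.adjoint_inner_left, hzero,
      inner_zero_left]
  exact hq (hh.linealitySubmodule.add_mem hl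
    (hdec.fderiv_mem_lineality_of_map_le_zero hp hsc hw.le))

theorem exists_pos_eventually_le_norm_adjoint (hdec : IsProperlyDecomposableAs p f xbar h c)
    (hp : p ≠ 0) (hsc : StrictComplementarity f xbar) :
    ∃ μ > 0, ∀ᶠ x in 𝓝 xbar, ∀ q ∉ lineality h, ∀ s ∈ subdifferential h q,
      μ ≤ ‖adjoint (fderiv ℝ c x) s‖ := by
  have hh := hdec.sublinear
  obtain ⟨K, hK⟩ := hh.exists_lipschitzWith
  let S := (hh.linealitySubmoduleᗮ : Set (Euc m)) ∩ Metric.sphere 0 1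
  have hS : IsCompact S :=
    (isCompact_sphere 0 1).inter_left (Submodule.isClosed_orthogonal _)
  have hS_lineality : ∀ q ∈ S, q ∉ lineality h := fun q hq hql =>
    ne_zero_of_mem_unit_sphere ⟨q, hq.2⟩ <|
      hh.linealitySubmodule.isOrtho_orthogonal_right.disjoint.le_bot ⟨hql, hq.1⟩
  obtain ⟨μ, hμ, hev⟩ := exists_pos_eventually_forall_le_of_isCompact
    (isCompact_biUnion_subdifferential hK hS)
    (continuous_adjoint_fderiv_apply (hdec.contDiff_one hp)).norm (x := xbar) fun s hs => by
      obtain ⟨q, hq, hsq⟩ := mem_iUnion₂.1 hs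
      exact norm_pos_iff.2 (hdec.adjoint_fderiv_ne_zero hp hsc (hS_lineality q hq) hsq)
  exact ⟨μ, hμ, hev.mono fun x hx q hq s hs =>
    hx s (hh.subdifferential_subset_biUnion_orthogonal_sphere hq hs)⟩

theorem isSmoothExtension_add_inner (hdec : IsProperlyDecomposableAs p f xbar h c)
    {s : Euc m} (hs : s ∈ subdifferential h 0) {V : Set (Euc d)} (hV : IsOpen V)
    (hfc : ∀ x ∈ V, f x = f xbar + h (c x)) {y : Euc d} (hy : y ∈ V) :
    IsSmoothExtension p f (c ⁻¹' lineality h) y V (fun x => f xbar + inner ℝ s (c x)) where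
  isOpen := hV
  mem := hy
  smooth := (contDiff_const.add (contDiff_const.inner ℝ hdec.smooth)).contDiffOn
  agree x hx := by rw [hfc x hx.1, hdec.sublinear.inner_eq_of_mem_lineality hs hx.2]

theorem isActiveManifold (hdec : IsProperlyDecomposableAs p f xbar h c) (hp : p ≠ 0)
    (hsc : StrictComplementarity f xbar) : IsActiveManifold p f xbar (c ⁻¹' lineality h) where
  mem := hdec.mem_preimage_lineality
  critical := intrinsicInterior_subset hsc
  manifold := hdec.isTransverseAt.isManifoldAround_preimage hp hdec.smooth
  smooth := by
    obtain ⟨s, hs⟩ := hdec.sublinear.nonempty_subdifferential_zero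
    obtain ⟨V, hfc, hV, hxV⟩ := eventually_nhds_iff.1 hdec.decomp
    exact ⟨V, _, hdec.isSmoothExtension_add_inner hs hV hfc hxV⟩
  sharp := by
    obtain ⟨μ, hμ, hev⟩ := hdec.exists_pos_eventually_le_norm_adjoint hp hsc
    refine ⟨_, hev.and (hdec.eventually_clarkeSubdifferential_subset hp), μ, hμ, ?_⟩
    rintro x ⟨⟨hx, hsub⟩, hxM⟩ v hv
    obtain ⟨s, hs, rfl⟩ := hsub hv
    exact hx (c x) hxM s hs

theorem eventually_covariantGradient_eq (hdec : IsProperlyDecomposableAs p f xbar h c)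
    (hp : p ≠ 0) : ∀ᶠ y in 𝓝 xbar, y ∈ c ⁻¹' lineality h → ∀ s ∈ subdifferential h 0,
      covariantGradient f (c ⁻¹' lineality h) y =
        (tangentSpace (c ⁻¹' lineality h) y).starProjection (adjoint (fderiv ℝ c y) s) := by
  have hdec_one : IsProperlyDecomposableAs 1 f xbar h c :=
    { hdec with smooth := by exact_mod_cast hdec.contDiff_one hp }
  have hM : IsManifoldAround 1 (c ⁻¹' lineality h) xbar :=
    hdec_one.isTransverseAt.isManifoldAround_preimage one_ne_zero hdec_one.smooth
  obtain ⟨V, hfc, hV, hxV⟩ := eventually_nhds_iff.1 hdec.decomp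
  filter_upwards [hM.eventually, hV.mem_nhds hxV] with y hMy hyV hy s hs
  have hgrad : HasGradientAt (fun x => f xbar + inner ℝ s (c x)) (adjoint (fderiv ℝ c y) s) y :=
    hasGradientAt_const_add_comp (hasGradientAt_iff_hasFDerivAt.2 (innerSL ℝ s).hasFDerivAt)
      ((hdec.contDiff_one hp).differentiable one_ne_zero y).hasFDerivAt _
  rw [covariantGradient_eq hMy hy (hdec_one.isSmoothExtension_add_inner hs hV hfc hyV),
    hgrad.gradient]

theorem strongA (hdec : IsProperlyDecomposableAs p f xbar h c) (hp : 2 ≤ p) :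
    StrongA f xbar (c ⁻¹' lineality h) := by
  have hh := hdec.sublinear
  have hp0 : p ≠ 0 := by omega
  obtain ⟨K, hK⟩ := hh.exists_lipschitzWith
  obtain ⟨C, r, hr, hC⟩ := exists_lipschitzOnWith_fderiv_ball
    (hdec.smooth.of_le (by exact_mod_cast hp)) xbar
  have hball : ∀ᶠ x in 𝓝 xbar, x ∈ Metric.ball xbar r := Metric.ball_mem_nhds xbar hr
  refine ⟨C * K + 1, by positivity, _, hball.and
    ((hdec.eventually_clarkeSubdifferential_subset hp0).and
      (hdec.eventually_covariantGradient_eq hp0)), ?_⟩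
  rintro x ⟨hxr, hsub, -⟩ v hv y ⟨hyM, hyr, -, hcov⟩
  obtain ⟨s, hs, rfl⟩ := hsub hv
  -- `∇_M f(y)` may be computed with the subgradient `s` that produces `v`.
  rw [hcov hyM s (hh.subdifferential_subset_zero _ hs)]
  set T := tangentSpace (c ⁻¹' lineality h) y
  calc ‖T.starProjection (adjoint (fderiv ℝ c x) s -
          T.starProjection (adjoint (fderiv ℝ c y) s))‖
      = ‖T.starProjection (adjoint (fderiv ℝ c x - fderiv ℝ c y) s)‖ := by
        have hidem := Submodule.starProjection_eq_self_iff.2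
          (Submodule.starProjection_apply_mem T (adjoint (fderiv ℝ c y) s))
        rw [map_sub, hidem, ← map_sub, map_sub adjoint, sub_apply]
    _ ≤ ‖adjoint (fderiv ℝ c x - fderiv ℝ c y) s‖ := Submodule.norm_starProjection_apply_le _ _
    _ ≤ ‖fderiv ℝ c x - fderiv ℝ c y‖ * ‖s‖ := by
        rw [← LinearIsometryEquiv.norm_map adjoint (fderiv ℝ c x - fderiv ℝ c y)]
        exact ContinuousLinearMap.le_opNorm _ s
    _ ≤ C * ‖x - y‖ * K := by
        gcongr
        · exact hC.norm_sub_le hxr hyr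
        · exact norm_le_of_mem_subdifferential hK hs
    _ ≤ (C * K + 1) * ‖x - y‖ := by linarith [norm_nonneg (x - y)]

theorem bLeRegular (hdec : IsProperlyDecomposableAs p f xbar h c) (hp : 2 ≤ p) :
    BLeRegular f xbar (c ⁻¹' lineality h) := by
  have hc : ContDiff ℝ 2 c := hdec.smooth.of_le (by exact_mod_cast hp)
  obtain ⟨K, hK⟩ := hdec.sublinear.exists_lipschitzWith
  obtain ⟨C, r, hr, hC⟩ := exists_lipschitzOnWith_fderiv_ball hc xbar
  have hball : ∀ᶠ x in 𝓝 xbar, x ∈ Metric.ball xbar r := Metric.ball_mem_nhds xbar hr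
  refine ⟨fun t => -(K * C) * t ^ 2, ?_, _, hball.and
    (hdec.decomp.and (hdec.eventually_clarkeSubdifferential_subset (by omega))), ?_⟩
  · have hlin : Tendsto (fun t : ℝ => -(K * C : ℝ) * t) (𝓝[≠] 0) (𝓝 0) :=
      (Continuous.tendsto' (by fun_prop) 0 0 (mul_zero _)).mono_left nhdsWithin_le_nhds
    refine hlin.congr' ?_
    filter_upwards [self_mem_nhdsWithin] with t (ht : t ≠ 0)
    field_simp
  · rintro x ⟨hxr, hfx, hsub⟩ v hv y ⟨-, hyr, hfy, -⟩
    obtain ⟨s, hs, rfl⟩ := hsub hv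
    have htaylor : |inner ℝ s (c y - c x - fderiv ℝ c x (y - x))| ≤ K * (C * ‖y - x‖ ^ 2) := by
      refine (abs_real_inner_le_norm _ _).trans ?_
      gcongr
      · exact norm_le_of_mem_subdifferential hK hs
      · exact norm_sub_sub_fderiv_le_of_lipschitzOnWith (convex_ball xbar r)
          (fun z _ => hc.differentiable two_ne_zero z) hC hyr hxr
    have hsubgrad := hs (c y)
    have hremainder := (abs_le.1 htaylor).1
    rw [inner_sub_right] at hremainder
    rw [hfx, hfy, ContinuousLinearMap.adjoint_inner_left]
    linarith

end IsProperlyDecomposableAs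

end NonsmoothOpt

theorem mainTheorem5_general {d m p : ℕ} (hp : 2 ≤ p) {f : NonsmoothOpt.Euc d → ℝ}
    {xbar : NonsmoothOpt.Euc d} {h : NonsmoothOpt.Euc m → ℝ}
    {c : NonsmoothOpt.Euc d → NonsmoothOpt.Euc m}
    (hdec : NonsmoothOpt.IsProperlyDecomposableAs p f xbar h c)
    (hsc : NonsmoothOpt.StrictComplementarity f xbar) :
    NonsmoothOpt.IsActiveManifold p f xbar (c ⁻¹' NonsmoothOpt.lineality h) ∧
      NonsmoothOpt.StrongA f xbar (c ⁻¹' NonsmoothOpt.lineality h) ∧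
      NonsmoothOpt.BLeRegular f xbar (c ⁻¹' NonsmoothOpt.lineality h) :=
  ⟨hdec.isActiveManifold (by omega) hsc, hdec.strongA hp, hdec.bLeRegular hp⟩

theorem mainTheorem5 {d m : ℕ} (f : NonsmoothOpt.Euc d → ℝ) (xbar : NonsmoothOpt.Euc d)
    (h : NonsmoothOpt.Euc m → ℝ) (c : NonsmoothOpt.Euc d → NonsmoothOpt.Euc m)
    (hLip : LocallyLipschitz f) (hmin : IsLocalMin f xbar)
    (hdec : NonsmoothOpt.IsProperlyDecomposableAs 4 f xbar h c)
    (hsc : NonsmoothOpt.StrictComplementarity f xbar)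
    (hgrowth : NonsmoothOpt.QuadraticGrowth f xbar) :
    NonsmoothOpt.AssumptionA f xbar (c ⁻¹' NonsmoothOpt.lineality h) := by
  obtain ⟨hactive, hstrongA, hbLe⟩ := mainTheorem5_general (by norm_num) hdec hsc
  exact ⟨hLip, hmin, hgrowth, hactive, hstrongA, hbLe⟩
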